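/- Let $\mathrm{FRel}$ be the category whose objects are finite sets and whose morphisms $X\to Y$ are all relations $R\subseteq X\times Y$, with the usual composition of relations. Let $\mathrm{Endo}(\mathrm{FRel})$ be the category whose objects are pairs $(X,R)$ with $X$ a finite set and $R\subseteq X\times X$, and whose morphisms $(X,R)\to(X',R')$ are the relations $S\subseteq X\times X'$ with $R'\circ S=S\circ R$. Let $\mathrm{Szym}(\mathrm{FRel})$ be the Szymczak category: it has the same objects, its morphisms $(X,R)\to(X',R')$ are the equivalence classes $[S,m]$ of pairs consisting of a morphism $S:(X,R)\to(X',R')$ of $\mathrm{Endo}(\mathrm{FRel})$ and $m\in\mathbb N=\{0,1,2,\dots\}$, where $(S,m)\equiv(S',m')$ if and only if $S\circ R^{m'+k}=S'\circ R^{m+k}$ for some $k\in\mathbb N$; composition is $[S',m']\circ[S,m]=[S'\circ S,m+m']$ and identities are $[\mathrm{id}_X,0]$. Call $x,y\in X$ strongly connected in $(X,R)$ if there are walks of positive length in $R$ from $x$ to $y$ and from $y$ to $x$. Call $(X,R)$ canonical if (i) every $x\in X$ is strongly connected to itself; (ii) for every strongly connected component $U$, that is, every set $U=\{y\in X: y\text{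 is strongly connected to }x\}$ with $x\in X$, the restriction $R\cap(U\times U)$ is (the graph of) a bijection $U\to U$; (iii) there is an integer $p\ge1$ such that $R^{n+p}=R^n$ for all $n\ge1$. **Theorem.** Let $(X,R)$ and $(X',R')$ be canonical. Then $(X,R)$ and $(X',R')$ are isomorphic in $\mathrm{Szym}(\mathrm{FRel})$ if and only if they are isomorphic in $\mathrm{Endo}(\mathrm{FRel})$. Moreover, they are isomorphic in $\mathrm{Endo}(\mathrm{FRel})$ if and only if they are conjugate by a bijection, i.e. there is a bijection $e:X\to X'$ such that $x\,R\,y\iff e(x)\,R'\,e(y)$ for all $x,y\in X$. -/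

import Mathlib

open CategoryTheory

universe v u

namespace Szymczak

section General

/-- Objects of the category of endomorphisms of `C`: an object together with an endomorphism. -/
structure Endo (C : Type u) [Category.{v} C] where
  /-- the underlying object -/
  obj : C
  /-- the endomorphism -/
  map : End obj

/-- A morphism `(E, e) ⟶ (F, f)` is a morphism `φ : E ⟶ F` with `f ∘ φ = φ ∘ e`. -/
@[ext]
structure Endo.Hom {C : Type u} [Category.{v} C] (X Y : Endo C) where
  /-- the underlying morphism of `C` -/
  hom : X.obj ⟶ Y.obj
  /-- it intertwines the two endomorphisms -/
  comm : hom ≫ Y.map = X.map ≫ hom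

instance Endo.category (C : Type u) [Category.{v} C] : Category.{v} (Endo C) where
  Hom X Y := Endo.Hom X Y
  id X := ⟨𝟙 X.obj, by rw [Category.id_comp, Category.comp_id]⟩
  comp f g := ⟨f.hom ≫ g.hom, by
    rw [Category.assoc, g.comm, ← Category.assoc, f.comm, Category.assoc]⟩
  id_comp f := Endo.Hom.ext (Category.id_comp f.hom)
  comp_id f := Endo.Hom.ext (Category.comp_id f.hom)
  assoc f g h := Endo.Hom.ext (Category.assoc f.hom g.hom h.hom)

variable {C : Type u} [Category.{v} C]

@[ext]
theorem Endo.hom_ext {X Y : Endo C} {f g : X ⟶ Y} (h : f.hom = g.hom) : f = g :=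
  Endo.Hom.ext h

@[simp]
theorem Endo.id_hom (X : Endo C) : (𝟙 X : X ⟶ X).hom = 𝟙 X.obj := rfl

@[simp]
theorem Endo.comp_hom {X Y Z : Endo C} (f : X ⟶ Y) (g : Y ⟶ Z) :
    (f ≫ g).hom = f.hom ≫ g.hom := rfl

/-- The `n`-th iterate `e ^ n : E ⟶ E` of the endomorphism of `(E, e)`. -/
def Endo.iter (X : Endo C) (n : ℕ) : X.obj ⟶ X.obj := (X.map ^ n : End X.obj)

theorem Endo.iter_add (X : Endo C) (m n : ℕ) : X.iter (m + n) = X.iter m ≫ X.iter n := by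
  have h : (X.map ^ (m + n) : End X.obj) = X.map ^ n * X.map ^ m := by
    rw [add_comm, pow_add]
  exact h

theorem Endo.iter_zero (X : Endo C) : X.iter 0 = 𝟙 X.obj := pow_zero X.map

theorem Endo.iter_one (X : Endo C) : X.iter 1 = X.map := pow_one X.map

theorem Endo.iter_comm {X Y : Endo C} (f : X ⟶ Y) (n : ℕ) :
    f.hom ≫ Y.iter n = X.iter n ≫ f.hom := by
  induction n with
  | zero => rw [Endo.iter_zero, Endo.iter_zero, Category.id_comp, Category.comp_id]
  | succ n ih =>
    rw [Endo.iter_add, Endo.iter_add, ← Category.assoc, ih, Category.assoc, Endo.iter_one,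
      Endo.iter_one, f.comm, Category.assoc]

/-- `(φ, m) ≡ (φ', m')` iff `φ ∘ e ^ (m' + k) = φ' ∘ e ^ (m + k)` for some natural number `k`. -/
def szymRel (X Y : Endo C) (a b : (X ⟶ Y) × ℕ) : Prop :=
  ∃ k : ℕ, X.iter (b.2 + k) ≫ a.1.hom = X.iter (a.2 + k) ≫ b.1.hom

theorem szymRel_equivalence (X Y : Endo C) : Equivalence (szymRel X Y) where
  refl _ := ⟨0, rfl⟩
  symm := fun ⟨k, hk⟩ => ⟨k, hk.symm⟩
  trans := by
    rintro ⟨f, l⟩ ⟨g, m⟩ ⟨h, n⟩ ⟨k, hk⟩ ⟨j, hj⟩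
    refine ⟨m + k + j, ?_⟩
    dsimp only at hk hj ⊢
    calc X.iter (n + (m + k + j)) ≫ f.hom
        = X.iter (n + j) ≫ X.iter (m + k) ≫ f.hom := by
          rw [← Category.assoc, ← Endo.iter_add]; congr 2; omega
      _ = X.iter (l + k) ≫ X.iter (n + j) ≫ g.hom := by
          rw [hk, ← Category.assoc, ← Category.assoc, ← Endo.iter_add, ← Endo.iter_add]
          congr 2; omega
      _ = X.iter (l + (m + k + j)) ≫ h.hom := by
          rw [hj, ← Category.assoc, ← Endo.iter_add]; congr 2; omega

/-- The setoid on `Hom_{Endo C}(X, Y) × ℕ` whose quotient is the set of Szymczak morphisms. -/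
def szymSetoid (X Y : Endo C) : Setoid ((X ⟶ Y) × ℕ) := ⟨szymRel X Y, szymRel_equivalence X Y⟩

/-- Composition on representatives: `[φ', m'] ∘ [φ, m] = [φ' ∘ φ, m + m']`. -/
def szymComp {X Y Z : Endo C} (a : Quotient (szymSetoid X Y)) (b : Quotient (szymSetoid Y Z)) :
    Quotient (szymSetoid X Z) :=
  Quotient.map₂ (sa := szymSetoid X Y) (sb := szymSetoid Y Z) (sc := szymSetoid X Z)
    (fun a b => (a.1 ≫ b.1, a.2 + b.2)) (by
      rintro ⟨f, l⟩ ⟨f', l'⟩ ⟨k, hk⟩ ⟨g, m⟩ ⟨g', m'⟩ ⟨j, hj⟩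
      refine ⟨k + j, ?_⟩
      dsimp only [Endo.comp_hom] at hk hj ⊢
      calc X.iter (l' + m' + (k + j)) ≫ f.hom ≫ g.hom
          = X.iter (m' + j) ≫ (X.iter (l' + k) ≫ f.hom) ≫ g.hom := by
            rw [Category.assoc, ← Category.assoc, ← Category.assoc, ← Category.assoc,
              ← Endo.iter_add]
            congr 3; omega
        _ = X.iter (l + k) ≫ (X.iter (m' + j) ≫ f'.hom) ≫ g.hom := by
            rw [hk]
            simp only [← Category.assoc, ← Endo.iter_add]
            congr 3; omega
        _ = X.iter (l + k) ≫ f'.hom ≫ Y.iter (m' + j) ≫ g.hom := by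
            rw [← Endo.iter_comm, Category.assoc]
        _ = X.iter (l + k) ≫ (f'.hom ≫ Y.iter (m + j)) ≫ g'.hom := by
            rw [hj, Category.assoc]
        _ = X.iter (l + m + (k + j)) ≫ f'.hom ≫ g'.hom := by
            rw [Endo.iter_comm]
            simp only [← Category.assoc, ← Endo.iter_add]
            congr 3; omega) a b

variable (C) in
/-- The Szymczak category has the same objects as the category of endomorphisms; `⟨X⟩` is the
object `X` regarded as an object of `Szym C`. -/
structure Szym where
  /-- the underlying object with an endomorphism -/
  as : Endo C

instance Szym.category : Category.{v} (Szym C) where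
  Hom X Y := Quotient (szymSetoid X.as Y.as)
  id X := Quotient.mk (szymSetoid X.as X.as) (𝟙 X.as, 0)
  comp f g := szymComp f g
  id_comp := by
    rintro X Y ⟨f, m⟩
    refine Quotient.sound (s := szymSetoid X.as Y.as) ⟨0, ?_⟩
    simp
  comp_id := by
    rintro X Y ⟨f, m⟩
    refine Quotient.sound (s := szymSetoid X.as Y.as) ⟨0, ?_⟩
    simp
  assoc := by
    rintro W X Y Z ⟨f, l⟩ ⟨g, m⟩ ⟨h, n⟩
    refine Quotient.sound (s := szymSetoid W.as Z.as) ⟨0, ?_⟩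
    simp [add_assoc]

end General

/-- Objects of the category of finite sets and binary relations. -/
structure FRel where
  /-- the underlying set -/
  carrier : Type u
  /-- it is finite -/
  finite : Finite carrier

/-- A morphism of `FRel` is an arbitrary relation, a subset of `X × Y`. -/
@[ext]
structure FRel.Hom (X Y : FRel.{u}) where
  /-- the underlying relation -/
  rel : SetRel X.carrier Y.carrier

/-- Composition in `FRel` is composition of relations, and identities are identity relations. -/
instance FRel.category : Category.{u} FRel.{u} where
  Hom X Y := FRel.Hom X Y
  id _ := ⟨SetRel.id⟩
  comp f g := ⟨f.rel.comp g.rel⟩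
  id_comp f := FRel.Hom.ext (SetRel.id_comp f.rel)
  comp_id f := FRel.Hom.ext (SetRel.comp_id f.rel)
  assoc f g h := FRel.Hom.ext (SetRel.comp_assoc f.rel g.rel h.rel)

@[ext]
theorem FRel.hom_ext {X Y : FRel.{u}} {f g : X ⟶ Y} (h : f.rel = g.rel) : f = g :=
  FRel.Hom.ext h

theorem FRel.mem_rel_id (X : FRel.{u}) (x x' : X.carrier) :
    (x, x') ∈ FRel.Hom.rel (𝟙 X) ↔ x = x' := Iff.rfl

theorem FRel.mem_rel_comp {X Y Z : FRel.{u}} (f : X ⟶ Y) (g : Y ⟶ Z) (x : X.carrier)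
    (z : Z.carrier) : (x, z) ∈ (f ≫ g).rel ↔ ∃ y, (x, y) ∈ f.rel ∧ (y, z) ∈ g.rel := Iff.rfl

namespace Endo

/-- The set of vertices of `(X, R)`. -/
abbrev Vert (X : Endo FRel.{u}) : Type u := X.obj.carrier

/-- `X.Edge x y` says that `x R y`. -/
def Edge (X : Endo FRel.{u}) (x y : X.Vert) : Prop := (x, y) ∈ FRel.Hom.rel X.map

/-- There is a walk of positive length from `x` to `y`. -/
def Reach (X : Endo FRel.{u}) (x y : X.Vert) : Prop := Relation.TransGen X.Edge x y

/-- `x` and `y` are strongly connected. -/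
def StronglyConn (X : Endo FRel.{u}) (x y : X.Vert) : Prop := X.Reach x y ∧ X.Reach y x

/-- The recurrent set of `(X, R)`. -/
def recurrentSet (X : Endo FRel.{u}) : Set X.Vert := {x | X.StronglyConn x x}

/-- The strongly connected component of (a recurrent vertex) `x`. -/
def component (X : Endo FRel.{u}) (x : X.Vert) : Set X.Vert := {y | X.StronglyConn x y}

/-- `p` is an eventual period of `R`: `p ≥ 1` and `R ^ (i + p) = R ^ i` for all `i ≥ p`. -/
def IsEventualPeriod (X : Endo FRel.{u}) (p : ℕ) : Prop :=
  1 ≤ p ∧ ∀ i : ℕ, p ≤ i → X.iter (i + p) = X.iter i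

/-- `(X, R)` is canonical (in canonical form). -/
structure IsCanonical (X : Endo FRel.{u}) : Prop where
  /-- every vertex is recurrent -/
  recurrent : X.recurrentSet = Set.univ
  /-- the restriction of `R` to each strongly connected component is (the graph of) a bijection -/
  bijective_restrict : ∀ x : X.Vert, ∃ g : X.component x → X.component x,
    Function.Bijective g ∧ ∀ a b : X.component x, X.Edge a b ↔ g a = b
  /-- the powers of `R` are periodic -/
  periodic : ∃ p : ℕ, X.IsEventualPeriod p ∧ ∀ n : ℕ, 1 ≤ n → X.iter (n + p) = X.iter n

end Endo

end Szymczak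

namespace Szymczak

namespace Endo

/-! ### Iterates and Szymczak morphisms in an arbitrary category -/

section General

variable {C : Type*} [Category* C]

/-! Choose a large common multiple `q` of the periods of `R` and `R'`. Then `R ^ q` and `R' ^ q` are
partial orders: reflexive by recurrence and periodicity, antisymmetric because walks of fixed length
inside a component are determined by their start (`iter_antisymm`). Absorbing an iterate into one
half of a Szymczak isomorphism gives intertwining relations `f : X → Y` and `T : Y → X` whose
composites are exactly `R ^ q` and `R' ^ q`. Such a pair contains a bijection
(`exists_equiv_of_comp_antisymm`), and it carries `R` to `R'` because `R ^ (q + 1) = R` and `R' ^ (q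
+ 1) = R'`. The remaining implications are formal. -/

/-- If the powers of `e` are periodic with period `p` from exponent `1` on, then also with every
multiple of `p`. -/
theorem iter_add_mul_of_periodic {X : Endo C} {p : ℕ}
    (hp : ∀ n : ℕ, 1 ≤ n → X.iter (n + p) = X.iter n) {n : ℕ} (hn : 1 ≤ n) (j : ℕ) :
    X.iter (n + p * j) = X.iter n := by
  induction j with
  | zero => rfl
  | succ j ih => rw [Nat.mul_succ, ← Nat.add_assoc, hp _ (by omega), ih]

/-- A representative of an identity of the Szymczak category agrees with an iterate of the
endomorphism after composition with every large enough iterate. -/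
theorem exists_iter_comp_eq_of_szymRel_id {X : Endo C} {f : X ⟶ X} {m : ℕ}
    (h : szymRel X X (f, m) (𝟙 X, 0)) :
    ∃ k : ℕ, ∀ b : ℕ, k ≤ b → X.iter b ≫ f.hom = X.iter (b + m) := by
  obtain ⟨k, hk⟩ := h
  refine ⟨k, fun b hb => ?_⟩
  obtain ⟨c, rfl⟩ := Nat.exists_eq_add_of_le hb
  simp only [Nat.zero_add, id_hom, Category.comp_id] at hk
  rw [Nat.add_comm k c, iter_add, Category.assoc, hk, ← iter_add, Nat.add_comm m k, Nat.add_assoc]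

/-- An isomorphism of endomorphisms induces an isomorphism in the Szymczak category. -/
def szymIso {X Y : Endo C} (i : X ≅ Y) : (⟨X⟩ : Szym C) ≅ ⟨Y⟩ where
  hom := Quotient.mk (szymSetoid X Y) (i.hom, 0)
  inv := Quotient.mk (szymSetoid Y X) (i.inv, 0)
  hom_inv_id := by
    refine Quotient.sound (s := szymSetoid X X) ⟨0, ?_⟩
    dsimp only
    rw [i.hom_inv_id]
  inv_hom_id := by
    refine Quotient.sound (s := szymSetoid Y Y) ⟨0, ?_⟩
    dsimp only
    rw [i.inv_hom_id]

end General

/-! ### Iterates of a relation as walks of fixed length -/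

variable {X Y : Endo FRel.{u}}

theorem mem_iter_add {m n : ℕ} {x y : X.Vert} :
    (x, y) ∈ (X.iter (m + n)).rel ↔ ∃ z, (x, z) ∈ (X.iter m).rel ∧ (z, y) ∈ (X.iter n).rel := by
  rw [iter_add, FRel.mem_rel_comp]

theorem mem_iter_zero {x y : X.Vert} : (x, y) ∈ (X.iter 0).rel ↔ x = y := by
  rw [iter_zero, FRel.mem_rel_id]

theorem mem_iter_succ {n : ℕ} {x y : X.Vert} :
    (x, y) ∈ (X.iter (n + 1)).rel ↔ ∃ z, (x, z) ∈ (X.iter n).rel ∧ X.Edge z y := by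
  rw [mem_iter_add, iter_one]
  rfl

theorem reach_iff_exists_mem_iter {x y : X.Vert} :
    X.Reach x y ↔ ∃ n : ℕ, (x, y) ∈ (X.iter (n + 1)).rel := by
  constructor
  · intro h
    induction h with
    | single h => exact ⟨0, mem_iter_succ.2 ⟨x, mem_iter_zero.2 rfl, h⟩⟩
    | tail _ h ih =>
      obtain ⟨n, hn⟩ := ih
      exact ⟨n + 1, mem_iter_succ.2 ⟨_, hn, h⟩⟩
  · rintro ⟨n, hn⟩
    induction n generalizing y with
    | zero =>
      obtain ⟨z, hz, h⟩ := mem_iter_succ.1 hn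
      rw [mem_iter_zero.1 hz]
      exact .single h
    | succ n ih =>
      obtain ⟨z, hz, h⟩ := mem_iter_succ.1 hn
      exact .tail (ih hz) h

theorem mem_iter_mul_self {n : ℕ} {x : X.Vert} (h : (x, x) ∈ (X.iter n).rel) (j : ℕ) :
    (x, x) ∈ (X.iter (n * j)).rel := by
  induction j with
  | zero => exact mem_iter_zero.2 rfl
  | succ j ih => exact mem_iter_add.2 ⟨x, ih, h⟩

namespace IsCanonical

theorem stronglyConn_self (hX : X.IsCanonical) (x : X.Vert) : X.StronglyConn x x := by
  have h : x ∈ X.recurrentSet := hX.recurrent ▸ Set.mem_univ x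
  exact h

/-- Walks of a given length inside a strongly connected component are determined by their
starting point. -/
theorem eq_of_mem_iter (hX : X.IsCanonical) {n : ℕ} {a b c : X.Vert}
    (hab : X.StronglyConn a b) (hac : X.StronglyConn a c)
    (hb : (a, b) ∈ (X.iter n).rel) (hc : (a, c) ∈ (X.iter n).rel) : b = c := by
  induction n generalizing b c with
  | zero => rw [← mem_iter_zero.1 hb, ← mem_iter_zero.1 hc]
  | succ n ih =>
    -- The penultimate vertex `d'` of a walk from `a` to `d` returns to `a` through `d`, so it stays
    -- in the component. A walk of length zero is no positive walk; there recurrence of `a` is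
    -- needed.
    have key : ∀ {d d' : X.Vert}, X.StronglyConn a d → (a, d') ∈ (X.iter n).rel → X.Edge d' d →
        X.StronglyConn a d' := by
      intro d d' hd hd' he
      refine ⟨?_, Relation.TransGen.head he hd.2⟩
      cases n with
      | zero => exact mem_iter_zero.1 hd' ▸ (hX.stronglyConn_self a).1
      | succ n => exact reach_iff_exists_mem_iter.2 ⟨n, hd'⟩
    obtain ⟨b', hb', heb⟩ := mem_iter_succ.1 hb
    obtain ⟨c', hc', hec⟩ := mem_iter_succ.1 hc
    obtain rfl : b' = c' := ih (key hab hb' heb) (key hac hc' hec) hb' hc'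
    obtain ⟨g, -, hg⟩ := hX.bijective_restrict a
    have h₁ := (hg ⟨b', key hab hb' heb⟩ ⟨b, hab⟩).1 heb
    have h₂ := (hg ⟨b', key hab hb' heb⟩ ⟨c, hac⟩).1 hec
    exact congrArg Subtype.val (h₁.symm.trans h₂)

/-- If `p ≥ 1` is a period of the positive powers of `R`, then `R ^ p` is reflexive. -/
theorem mem_iter_self (hX : X.IsCanonical) {p : ℕ}
    (hp : ∀ n : ℕ, 1 ≤ n → X.iter (n + p) = X.iter n) (hp₁ : 1 ≤ p) (x : X.Vert) :
    (x, x) ∈ (X.iter p).rel := by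
  obtain ⟨n, hn⟩ := reach_iff_exists_mem_iter.1 (hX.stronglyConn_self x).1
  -- Going `p` times round a closed walk of length `n + 1` takes `p + p * n` steps, which is `p`
  -- modulo the period.
  have h := mem_iter_mul_self hn p
  rwa [show (n + 1) * p = p + p * n by ring, iter_add_mul_of_periodic hp hp₁] at h

/-- If `p ≥ 1` is a period of the positive powers of `R`, then `R ^ p` is antisymmetric. -/
theorem iter_antisymm (hX : X.IsCanonical) {p : ℕ}
    (hp : ∀ n : ℕ, 1 ≤ n → X.iter (n + p) = X.iter n) (hp₁ : 1 ≤ p) {x y : X.Vert}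
    (hxy : (x, y) ∈ (X.iter p).rel) (hyx : (y, x) ∈ (X.iter p).rel) : x = y := by
  obtain ⟨n, rfl⟩ := Nat.exists_eq_add_of_le' hp₁
  exact hX.eq_of_mem_iter (hX.stronglyConn_self x)
    ⟨reach_iff_exists_mem_iter.2 ⟨n, hxy⟩, reach_iff_exists_mem_iter.2 ⟨n, hyx⟩⟩
    (hX.mem_iter_self hp hp₁ x) hxy

end IsCanonical

/-- Relations `S : X → Y` and `T : Y → X` whose composites are reflexive and antisymmetric
determine a bijection contained in both `S` and the converse of `T`. -/
theorem exists_equiv_of_comp_antisymm {α β : Type*} {S : α → β → Prop} {T : β → α → Prop}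
    (hα : ∀ x, ∃ y, S x y ∧ T y x) (hβ : ∀ y, ∃ x, T y x ∧ S x y)
    (aα : ∀ x x' y y', S x y → T y x' → S x' y' → T y' x → x = x')
    (aβ : ∀ y y' x x', T y x → S x y' → T y' x' → S x' y → y = y') :
    ∃ e : α ≃ β, ∀ x, S x (e x) ∧ T (e x) x := by
  choose f hf using hα
  choose g hg using hβ
  -- `x` and `g (f x)` are both `S`-related to `f x`, and `f x` is `T`-related to both, so
  -- antisymmetry identifies them; likewise for `y` and `f (g y)`.
  exact ⟨⟨f, g, fun x => aα _ _ _ _ (hg (f x)).2 (hf x).2 (hf x).1 (hg (f x)).1,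
    fun y => aβ _ _ _ _ (hf (g y)).2 (hg y).2 (hg y).1 (hf (g y)).1⟩, hf⟩

/-- Canonical relations that are isomorphic in the Szymczak category are conjugate by a
bijection. -/
theorem exists_conj_of_szymIso (hX : X.IsCanonical) (hY : Y.IsCanonical)
    (i : (⟨X⟩ : Szym FRel.{u}) ≅ ⟨Y⟩) :
    ∃ e : X.Vert ≃ Y.Vert, ∀ x x' : X.Vert, X.Edge x x' ↔ Y.Edge (e x) (e x') := by
  obtain ⟨hom, inv, hom_inv, inv_hom⟩ := i
  obtain ⟨⟨f, m⟩, rfl⟩ := Quotient.exists_rep hom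
  obtain ⟨⟨g, n⟩, rfl⟩ := Quotient.exists_rep inv
  obtain ⟨k, hk⟩ : ∃ k : ℕ, ∀ b : ℕ, k ≤ b → X.iter b ≫ (f ≫ g).hom = X.iter (b + (m + n)) :=
    exists_iter_comp_eq_of_szymRel_id (Quotient.exact (s := szymSetoid X X) hom_inv)
  obtain ⟨l, hl⟩ : ∃ l : ℕ, ∀ b : ℕ, l ≤ b → Y.iter b ≫ (g ≫ f).hom = Y.iter (b + (n + m)) :=
    exists_iter_comp_eq_of_szymRel_id (Quotient.exact (s := szymSetoid Y Y) inv_hom)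
  obtain ⟨p, ⟨hp₁, -⟩, hp⟩ := hX.periodic
  obtain ⟨r, ⟨hr₁, -⟩, hr⟩ := hY.periodic
  -- The factor `k + l + m + n + 1` makes `q` large enough that `b = q - (m + n)` exceeds both
  -- thresholds.
  obtain ⟨q, hq₁, ⟨s, hs⟩, ⟨t, ht⟩, b, hkb, hlb, hb⟩ : ∃ q : ℕ, 1 ≤ q ∧ p ∣ q ∧ r ∣ q ∧
      ∃ b : ℕ, k ≤ b ∧ l ≤ b ∧ b + (m + n) = q := by
    have hle : k + l + m + n + 1 ≤ p * r * (k + l + m + n + 1) :=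
      Nat.le_mul_of_pos_left _ (Nat.mul_pos hp₁ hr₁)
    refine ⟨p * r * (k + l + m + n + 1), by omega, ⟨r * (k + l + m + n + 1), by ring⟩,
      ⟨p * (k + l + m + n + 1), by ring⟩, p * r * (k + l + m + n + 1) - (m + n), ?_, ?_, ?_⟩ <;>
    omega
  have hqX : ∀ n : ℕ, 1 ≤ n → X.iter (n + q) = X.iter n := fun n hn => by
    rw [hs, iter_add_mul_of_periodic hp hn]
  have hqY : ∀ n : ℕ, 1 ≤ n → Y.iter (n + q) = Y.iter n := fun n hn => by
    rw [ht, iter_add_mul_of_periodic hr hn]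
  -- The factor `Y.iter b` completes the shift `m + n` to `q`, so both composites with `f` become
  -- `q`-th iterates.
  let T : Y.obj ⟶ X.obj := Y.iter b ≫ g.hom
  have hfT : f.hom ≫ T = X.iter q := by
    rw [← hb, ← hk b hkb, comp_hom, ← Category.assoc, iter_comm, Category.assoc]
  have hTf : T ≫ f.hom = Y.iter q := by
    rw [← hb, Nat.add_comm m n, ← hl b hlb, comp_hom, Category.assoc]
  have hT : T ≫ X.map = Y.map ≫ T := by
    have h := iter_comm g 1
    rw [iter_one, iter_one] at h
    rw [Category.assoc, g.comm, ← Category.assoc, ← Category.assoc]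
    congr 1
    rw [← iter_one Y, ← iter_add, ← iter_add, Nat.add_comm]
  -- Moving `T` past the endomorphism leaves `R ^ (q + 1)`, which is `R` by periodicity from
  -- exponent `1` on.
  have hXmap : f.hom ≫ Y.map ≫ T = X.map := by
    rw [← hT, ← Category.assoc, hfT, ← iter_one X, ← iter_add, Nat.add_comm, hqX 1 le_rfl]
  have hYmap : T ≫ X.map ≫ f.hom = Y.map := by
    rw [← f.comm, ← Category.assoc, hTf, ← iter_one Y, ← iter_add, Nat.add_comm, hqY 1 le_rfl]
  have mX : ∀ {x x'}, (x, x') ∈ (X.iter q).rel ↔ ∃ y, (x, y) ∈ f.hom.rel ∧ (y, x') ∈ T.rel := by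
    intro x x'
    rw [← hfT, FRel.mem_rel_comp]
  have mY : ∀ {y y'}, (y, y') ∈ (Y.iter q).rel ↔ ∃ x, (y, x) ∈ T.rel ∧ (x, y') ∈ f.hom.rel := by
    intro y y'
    rw [← hTf, FRel.mem_rel_comp]
  obtain ⟨e, he⟩ := exists_equiv_of_comp_antisymm
    (S := fun x y => (x, y) ∈ f.hom.rel) (T := fun y x => (y, x) ∈ T.rel)
    (fun x => mX.1 (hX.mem_iter_self hqX hq₁ x)) (fun y => mY.1 (hY.mem_iter_self hqY hq₁ y))
    (fun x x' y y' h₁ h₂ h₃ h₄ =>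
      hX.iter_antisymm hqX hq₁ (mX.2 ⟨y, h₁, h₂⟩) (mX.2 ⟨y', h₃, h₄⟩))
    (fun y y' x x' h₁ h₂ h₃ h₄ =>
      hY.iter_antisymm hqY hq₁ (mY.2 ⟨x, h₁, h₂⟩) (mY.2 ⟨x', h₃, h₄⟩))
  -- An edge is transported by attaching a `T`-step and an `f`-step at its two ends.
  refine ⟨e, fun x x' => ⟨fun h => ?_, fun h => ?_⟩⟩
  · rw [Edge, ← hYmap]
    exact ⟨x, (he x).2, x', h, (he x').1⟩
  · rw [Edge, ← hXmap]
    exact ⟨e x, (he x).1, e x', h, (he x').2⟩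

/-! ### From a conjugating bijection to an isomorphism -/

/-- A bijection conjugating two relations is an isomorphism in the category of endomorphisms. -/
def isoOfConj (e : X.Vert ≃ Y.Vert)
    (he : ∀ x x' : X.Vert, X.Edge x x' ↔ Y.Edge (e x) (e x')) : X ≅ Y where
  hom := ⟨⟨{a | e a.1 = a.2}⟩, by
    ext ⟨x, y⟩
    constructor
    · rintro ⟨_, (rfl : e x = _), h⟩
      exact ⟨e.symm y, (he _ _).2 (by rw [e.apply_symm_apply]; exact h), e.apply_symm_apply y⟩
    · rintro ⟨x', h, (rfl : e x' = y)⟩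
      exact ⟨e x, rfl, (he _ _).1 h⟩⟩
  inv := ⟨⟨{a | e a.2 = a.1}⟩, by
    ext ⟨y, x⟩
    constructor
    · rintro ⟨x', (rfl : e x' = y), h⟩
      exact ⟨e x, (he _ _).1 h, rfl⟩
    · rintro ⟨_, h, (rfl : e x = _)⟩
      exact ⟨e.symm y, e.apply_symm_apply y, (he _ _).2 (by rw [e.apply_symm_apply]; exact h)⟩⟩
  hom_inv_id := by
    ext ⟨x, x'⟩
    constructor
    · rintro ⟨_, (rfl : e x = _), h⟩
      exact (e.injective h).symm
    · intro h
      obtain rfl : x = x' := h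
      exact ⟨e x, rfl, rfl⟩
  inv_hom_id := by
    ext ⟨y, y'⟩
    constructor
    · rintro ⟨x, (rfl : e x = y), (rfl : e x = y')⟩
      rfl
    · intro h
      obtain rfl : y = y' := h
      exact ⟨e.symm y, e.apply_symm_apply y, e.apply_symm_apply y⟩

end Endo

end Szymczak

theorem theorem2p2 (X Y : Szymczak.Endo Szymczak.FRel.{u})
    (hX : X.IsCanonical) (hY : Y.IsCanonical) :
    (Nonempty ((⟨X⟩ : Szymczak.Szym Szymczak.FRel.{u}) ≅ ⟨Y⟩) ↔ Nonempty (X ≅ Y)) ∧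
    (Nonempty (X ≅ Y) ↔
      ∃ e : X.Vert ≃ Y.Vert, ∀ x x' : X.Vert, X.Edge x x' ↔ Y.Edge (e x) (e x')) := by
  refine ⟨⟨?_, ?_⟩, ?_, ?_⟩
  · rintro ⟨i⟩
    obtain ⟨e, he⟩ := Szymczak.Endo.exists_conj_of_szymIso hX hY i
    exact ⟨Szymczak.Endo.isoOfConj e he⟩
  · rintro ⟨i⟩
    exact ⟨Szymczak.Endo.szymIso i⟩
  · rintro ⟨i⟩
    exact Szymczak.Endo.exists_conj_of_szymIso hX hY (Szymczak.Endo.szymIso i)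
  · rintro ⟨e, he⟩
    exact ⟨Szymczak.Endo.isoOfConj e he⟩
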